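/- Let $n$ units be given and let $0<n_1<n$. The covariate rows $x_1,\dots,x_n\in\mathbb{R}^k$ are independent draws from a common ellipsoidal distribution $EC_k(\mu,\Sigma,\psi)$ with $\Sigma$ positive definite (that is, $h\mapsto\psi(h\Sigma h')$ is the characteristic function of $x_i-\mu$) and with finite second moments. The treatment assignment $W$ is independent of the covariates and uniformly distributed on $\{W\in\{0,1\}^n:\sum_i W_i=n_1\}$. The $k$ covariates are partitioned into tiers $1,\dots,T$, and $x_i^{(t)}$ is the part of $x_i$ in tier $t$. Let $z_i^{(t)}$ be the residual of the (population, $L^2$) linear projection of $x_i^{(t)}$ on $(1,x_i^{(1)},\dots,x_i^{(t-1)})$ (block-wise Gram--Schmidt orthogonalization), and let $z=(z^{(1)},\dots,z^{(T)})$ be the matrix with rows $z_i=(z_i^{(1)},\dots,z_i^{(T)})$. Let $\varphi(z,W)\in[0,1]$ be a measurable balance criterion that is unchanged when, for any single tier $t$, all the rows $z_i^{(t)}$ are replaced by $z_i^{(t)}A+b$ with $A$ an invertible matrix and $b$ a vector. Conditionally on the covariates and $W$, let the acceptance indicator $\delta$ be Bernoulli with success probability $\varphi(z,W)$, and suppose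 $\Pr(\delta=1)>0$. For any quantity, let $\overline{(\cdot)}_1-\overline{(\cdot)}_0$ denote its treatment group mean minus its control group mean. Then for each tier $t$ there is $\nu_t\in\mathbb{R}$ with $$\operatorname{cov}\left(\overline z^{(t)}_1-\overline z^{(t)}_0\mid\delta=1\right)=\nu_t\operatorname{cov}\left(\overline z^{(t)}_1-\overline z^{(t)}_0\right).$$ Moreover, for any such $\nu_1,\dots,\nu_T$ and every linear combination $Y_i=x_i\gamma$ of the covariates with $\operatorname{var}(\overline Y_1-\overline Y_0)\neq0$, $$\frac{\operatorname{var}\left(\overline Y_1-\overline Y_0\right)-\operatorname{var}\left(\overline Y_1-\overline Y_0\mid\delta=1\right)}{\operatorname{var}\left(\overline Y_1-\overline Y_0\right)}=1-\sum_{t=1}^{T}R_t^2\,\nu_t,$$ where $R_t^2$ is the squared multiple correlation coefficient between $\overline Y_1-\overline Y_0$ and $\overline z^{(t)}_1-\overline z^{(t)}_0$. -/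

import Mathlib

open MeasureTheory ProbabilityTheory Matrix

/-- The random vector `X`, under `P`, has the ellipsoidal distribution `EC_k(m, S, ψ)`: `S` is
positive semi-definite and the characteristic function of `X - m` is `h ↦ ψ (h S h')`. -/
def IsEllipsoidal {Ω : Type*} [MeasurableSpace Ω] (P : Measure Ω) {k : ℕ}
    (X : Ω → Fin k → ℝ) (m : Fin k → ℝ) (S : Matrix (Fin k) (Fin k) ℝ) (ψ : ℝ → ℂ) : Prop :=
  S.PosSemidef ∧ ∀ h : Fin k → ℝ,
    charFun (P.map fun ω => WithLp.toLp 2 (X ω - m)) (WithLp.toLp 2 h) = ψ (h ⬝ᵥ S *ᵥ h)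

/-- The set of treatment assignments of `n` units with exactly `n₁` treated units
(`true` = treated, `false` = control). -/
def assignments (n n₁ : ℕ) : Set (Fin n → Bool) :=
  {w | (Finset.univ.filter fun i => w i = true).card = n₁}

/-- Treatment group mean minus control group mean of the values `v`. -/
noncomputable def meanDiff {n : ℕ} (w : Fin n → Bool) (v : Fin n → ℝ) : ℝ :=
  (∑ i with w i = true, v i) / (Finset.univ.filter fun i => w i = true).card
    - (∑ i with w i = false, v i) / (Finset.univ.filter fun i => w i = false).card

/-- Covariate `j` belongs to tier `τ j`. Subtract from covariate `j` of the row `v` the affine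
function, with intercept `a j` and coefficients `B · j`, of the covariates of the earlier tiers. -/
noncomputable def tierResidual {k T : ℕ} (τ : Fin k → Fin T) (a : Fin k → ℝ)
    (B : Matrix (Fin k) (Fin k) ℝ) (v : Fin k → ℝ) (j : Fin k) : ℝ :=
  v j - (a j + ∑ l with τ l < τ j, v l * B l j)

/-- `(a, B)` are the coefficients of the block-wise Gram-Schmidt orthogonalization of the random
vector `X`: the residual of each covariate is orthogonal, in `L²(P)`, to the constant `1` and to
all covariates of the earlier tiers. -/
def IsBlockGramSchmidt {Ω : Type*} [MeasurableSpace Ω] (P : Measure Ω) {k T : ℕ}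
    (τ : Fin k → Fin T) (X : Ω → Fin k → ℝ) (a : Fin k → ℝ)
    (B : Matrix (Fin k) (Fin k) ℝ) : Prop :=
  ∀ j : Fin k, ∫ ω, tierResidual τ a B (X ω) j ∂P = 0 ∧
    ∀ l : Fin k, τ l < τ j → ∫ ω, tierResidual τ a B (X ω) j * X ω l ∂P = 0

/-- Apply the affine map `u ↦ u A + b` to the tier-`t` part of every row of the covariate matrix
`z`, leaving the other tiers unchanged. -/
def affineOnTier {n k T : ℕ} (τ : Fin k → Fin T) (t : Fin T)
    (A : Matrix {j // τ j = t} {j // τ j = t} ℝ) (b : {j // τ j = t} → ℝ)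
    (z : Fin n → Fin k → ℝ) : Fin n → Fin k → ℝ :=
  fun i j => if h : τ j = t then ((fun l : {l // τ l = t} => z i l) ᵥ* A + b) ⟨j, h⟩ else z i j

/-- A stochastic balance criterion: a measurable function of covariates and assignment with
values in `[0, 1]`. -/
def IsBalanceCriterion {n k : ℕ} (φ : (Fin n → Fin k → ℝ) → (Fin n → Bool) → ℝ) : Prop :=
  Measurable (Function.uncurry φ) ∧ ∀ z w, φ z w ∈ Set.Icc (0 : ℝ) 1

/-- Subspace-conditional affine invariance: invariance under every invertible affine map applied
to any single tier. -/
def IsTierAffinelyInvariant {n k T : ℕ} (τ : Fin k → Fin T)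
    (φ : (Fin n → Fin k → ℝ) → (Fin n → Bool) → ℝ) : Prop :=
  ∀ (t : Fin T) (A : Matrix {j // τ j = t} {j // τ j = t} ℝ) (b : {j // τ j = t} → ℝ),
    IsUnit A → ∀ z w, φ (affineOnTier τ t A b z) w = φ z w

/-- Conditionally on the random variable `D`, the binary variable `δ` is Bernoulli with success
probability `p`. -/
def IsCondBernoulli {Ω : Type*} [MeasurableSpace Ω] (P : Measure Ω) {E : Type*}
    [mE : MeasurableSpace E] (D : Ω → E) (δ : Ω → Bool) (p : Ω → ℝ) : Prop :=
  P[Set.indicator {ω | δ ω = true} (fun _ => (1 : ℝ)) | mE.comap D] =ᵐ[P] p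

/-- Covariance matrix of the random vector `V` under `P`. -/
noncomputable def covMatrix {Ω : Type*} [MeasurableSpace Ω] (P : Measure Ω) {ι : Type*}
    (V : Ω → ι → ℝ) : Matrix ι ι ℝ :=
  Matrix.of fun j l => cov[fun ω => V ω j, fun ω => V ω l; P]

/-- Squared multiple correlation coefficient between `Y` and the random vector `V`,
`cov(Y, V) cov(V)⁻¹ cov(V, Y) / var(Y)`, for `cov(V)` non-singular and `var(Y) ≠ 0`. -/
noncomputable def sqMultipleCorr {Ω : Type*} [MeasurableSpace Ω] (P : Measure Ω) {ι : Type*}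
    [Fintype ι] [DecidableEq ι] (Y : Ω → ℝ) (V : Ω → ι → ℝ) : ℝ :=
  ((fun j => cov[Y, fun ω => V ω j; P]) ⬝ᵥ
    (covMatrix P V)⁻¹ *ᵥ (fun j => cov[Y, fun ω => V ω j; P])) / Var[Y; P]

/-- The random vector of mean differences of the tier-`t` columns of the random covariate matrix
`Z` under the random assignment `W`. -/
noncomputable def tierMeanDiff {Ω : Type*} {n k T : ℕ} (τ : Fin k → Fin T) (t : Fin T)
    (Z : Ω → Fin n → Fin k → ℝ) (W : Ω → Fin n → Bool) : Ω → {j // τ j = t} → ℝ :=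
  fun ω j => meanDiff (W ω) fun i => Z ω i j

/-! The proof rests on reflections. The residuals `z` are linear images of the centred covariates,
so they are ellipsoidal. Their scale matrix `M` may be taken block diagonal over the tiers
(`exists_blockDiagonal_scale`), and every `M`-reflection preserves the law of a row, hence the joint
law of all rows with the independent `W` (`map_rows_prod_eq`). A reflection along a vector of one
tier is an affine map of that tier (`exists_affineOnTier_eq_rowReflection`), so it leaves `φ`
unchanged and remains a symmetry after conditioning on acceptance (`IsCondBernoulli.cond_map_eq`).

A symmetric form with all these symmetries is block diagonal and a multiple of `M` on each tier
(`exists_smul_of_reflection_invariant`). This applies to the covariance of the mean differences both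
before and after conditioning, so the two are proportional tier by tier. The mean difference of `x
γ` is almost surely linear in those of `z`. Its variance is a sum over tiers, before conditioning
the share of tier `t` is `R_t²`, and conditioning multiplies that contribution by `ν_t`. -/

/-! ### Block triangular residual maps, reflections and invariant forms. -/

section LinearAlgebra

variable {k T : ℕ}

/-- The unit block triangular matrix that sends a row of covariates to its tier residuals, up to
the intercepts. -/
def residualMatrix (τ : Fin k → Fin T) (B : Matrix (Fin k) (Fin k) ℝ) : Matrix (Fin k) (Fin k) ℝ :=
  Matrix.of fun l j => (1 : Matrix (Fin k) (Fin k) ℝ) l j - if τ l < τ j then B l j else 0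

lemma tierResidual_eq (τ : Fin k → Fin T) (a : Fin k → ℝ) (B : Matrix (Fin k) (Fin k) ℝ)
    (v : Fin k → ℝ) : tierResidual τ a B v = v ᵥ* residualMatrix τ B - a := by
  ext j
  simp only [tierResidual, residualMatrix, vecMul, dotProduct, Matrix.of_apply, Pi.sub_apply,
    mul_sub, Finset.sum_sub_distrib, Matrix.one_apply, mul_ite, mul_one, mul_zero,
    Finset.sum_ite_eq', Finset.mem_univ, if_true, Finset.sum_filter]
  ring

/-- Only earlier tiers are subtracted, so the matrix is block triangular with identity diagonal
blocks. Invertibility keeps the transformed scale matrix positive definite and lets any `γ` be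
expressed through the residuals. -/
lemma residualMatrix_isUnit (τ : Fin k → Fin T) (B : Matrix (Fin k) (Fin k) ℝ) :
    IsUnit (residualMatrix τ B) := by
  rw [Matrix.isUnit_iff_isUnit_det]
  have h : (residualMatrix τ B).BlockTriangular τ := by
    intro i j hij
    have hne : i ≠ j := by rintro rfl; exact lt_irrefl _ hij
    simp [residualMatrix, Matrix.one_apply_ne hne, not_lt.mpr hij.le]
  rw [h.det_fintype]
  have h1 : ∀ t, (residualMatrix τ B).toSquareBlock τ t = 1 := by
    intro t
    ext ⟨i, hi⟩ ⟨j, hj⟩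
    simp [Matrix.toSquareBlock, Matrix.toSquareBlockProp, residualMatrix, Matrix.one_apply, hi, hj]
  simp [h1]

/-- The transformation of linear functionals given by the reflection in the hyperplane
`M`-orthogonal to `u`. -/
noncomputable def dualReflection (M : Matrix (Fin k) (Fin k) ℝ) (u h : Fin k → ℝ) : Fin k → ℝ :=
  h - (2 * (h ⬝ᵥ M *ᵥ u) / (u ⬝ᵥ M *ᵥ u)) • u

/-- The transformation of row vectors given by the reflection in the hyperplane `M`-orthogonal
to `u`. -/
noncomputable def rowReflection (M : Matrix (Fin k) (Fin k) ℝ) (u v : Fin k → ℝ) : Fin k → ℝ :=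
  v - (2 * (v ⬝ᵥ u) / (u ⬝ᵥ M *ᵥ u)) • (M *ᵥ u)

/-- Adjointness moves a reflection of the data onto the test functional, in characteristic functions
and in covariances alike. -/
lemma rowReflection_dotProduct (M : Matrix (Fin k) (Fin k) ℝ) (u v h : Fin k → ℝ) :
    rowReflection M u v ⬝ᵥ h = v ⬝ᵥ dualReflection M u h := by
  simp only [rowReflection, dualReflection, sub_dotProduct, dotProduct_sub, smul_dotProduct,
    dotProduct_smul, smul_eq_mul, dotProduct_comm h (M *ᵥ u)]
  ring

lemma dotProduct_mulVec_comm {ι : Type*} [Fintype ι] {M : Matrix ι ι ℝ} (hM : M.IsSymm)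
    (u v : ι → ℝ) : u ⬝ᵥ M *ᵥ v = v ⬝ᵥ M *ᵥ u := by
  rw [dotProduct_mulVec, ← mulVec_transpose, hM.eq, dotProduct_comm]

lemma dualReflection_quadratic {M : Matrix (Fin k) (Fin k) ℝ} (hM : M.IsSymm) (u h : Fin k → ℝ)
    (hu : u ⬝ᵥ M *ᵥ u ≠ 0) :
    dualReflection M u h ⬝ᵥ M *ᵥ dualReflection M u h = h ⬝ᵥ M *ᵥ h := by
  simp only [dualReflection, mulVec_sub, mulVec_smul, sub_dotProduct, dotProduct_sub,
    smul_dotProduct, dotProduct_smul, smul_eq_mul, dotProduct_mulVec_comm hM u h]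
  field_simp
  ring

lemma measurable_rowReflection (M : Matrix (Fin k) (Fin k) ℝ) (u : Fin k → ℝ) :
    Measurable (rowReflection M u) := by
  unfold rowReflection
  simp only [dotProduct]
  fun_prop

/-- If a vector vanishes outside tier `t`, so does its image under a block diagonal matrix. -/
lemma mulVec_eq_zero_of_tier {τ : Fin k → Fin T} {M : Matrix (Fin k) (Fin k) ℝ}
    (hM : ∀ j l, τ j ≠ τ l → M j l = 0) {t : Fin T} {u : Fin k → ℝ}
    (hu : ∀ j, τ j ≠ t → u j = 0) {j : Fin k} (hj : τ j ≠ t) : (M *ᵥ u) j = 0 := by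
  change ∑ l, M j l * u l = 0
  refine Finset.sum_eq_zero fun l _ => ?_
  by_cases hl : τ l = t
  · rw [hM j l (by rw [hl]; exact hj), zero_mul]
  · rw [hu l hl, mul_zero]

/-- A reflection along a vector of tier `t` is an invertible affine map of that tier. -/
lemma exists_affineOnTier_eq_rowReflection {n : ℕ} {τ : Fin k → Fin T}
    {M : Matrix (Fin k) (Fin k) ℝ} (hM : ∀ j l, τ j ≠ τ l → M j l = 0) {t : Fin T}
    {u : Fin k → ℝ} (hu : ∀ j, τ j ≠ t → u j = 0) (hu0 : u ⬝ᵥ M *ᵥ u ≠ 0) :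
    ∃ A : Matrix {j // τ j = t} {j // τ j = t} ℝ, IsUnit A ∧
      ∀ z : Fin n → Fin k → ℝ,
        affineOnTier τ t A 0 z = fun i => rowReflection M u (z i) := by
  set c := 2 / (u ⬝ᵥ M *ᵥ u) with hc
  set p : {j // τ j = t} → ℝ := fun l => u l
  set r : {j // τ j = t} → ℝ := fun l => (M *ᵥ u) l
  have hsub : ∀ v : Fin k → ℝ, (fun l : {l // τ l = t} => v l) ⬝ᵥ p = v ⬝ᵥ u := by
    intro v
    simp only [dotProduct, p]
    rw [← Finset.sum_subtype (Finset.univ.filter fun l => τ l = t) (by simp) fun l => v l * u l,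
      Finset.sum_filter_of_ne]
    intro l _ h
    by_contra hl
    exact h (by rw [hu l hl, mul_zero])
  have hrp : r ⬝ᵥ p = u ⬝ᵥ M *ᵥ u := by rw [hsub (M *ᵥ u), dotProduct_comm]
  -- The reflection restricted to the tier is a rank-one perturbation of the identity. The choice of
  -- `c` and `r ⬝ᵥ p = u ⬝ᵥ M *ᵥ u` make it an involution, hence its own inverse.
  refine ⟨1 - c • vecMulVec p r, ?_, ?_⟩
  · refine IsUnit.of_mul_eq_one (1 - c • vecMulVec p r) ?_
    have : vecMulVec p r * vecMulVec p r = (u ⬝ᵥ M *ᵥ u) • vecMulVec p r := by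
      rw [vecMulVec_mul_vecMulVec, hrp]
      ext i j
      simp only [vecMulVec_apply, Matrix.smul_apply, Pi.smul_apply, smul_eq_mul]
      ring
    have h2 : c * c * (u ⬝ᵥ M *ᵥ u) = c + c := by rw [hc]; field_simp; norm_num
    have h3 : (c • vecMulVec p r) * (c • vecMulVec p r)
        = c • vecMulVec p r + c • vecMulVec p r := by
      rw [Matrix.smul_mul, Matrix.mul_smul, this, smul_smul, smul_smul, h2, add_smul]
    rw [sub_mul, one_mul, mul_sub, mul_one, h3]
    abel
  · intro z
    ext i j
    simp only [affineOnTier]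
    split_ifs with h
    · simp only [vecMul_sub, vecMul_one, vecMul_smul, vecMul_vecMulVec, hsub, rowReflection,
        Pi.add_apply, Pi.sub_apply, Pi.smul_apply, smul_eq_mul, Pi.zero_apply, r, hc]
      simp
      ring
    · simp [rowReflection, mulVec_eq_zero_of_tier hM hu h]

/-- A bilinear form invariant under the `M`-reflection along `u` pairs with `u` proportionally
to `M`. -/
lemma reflection_invariant_form {M C : Matrix (Fin k) (Fin k) ℝ} {u : Fin k → ℝ}
    (hu : u ⬝ᵥ M *ᵥ u ≠ 0)
    (hC : ∀ h g, dualReflection M u h ⬝ᵥ C *ᵥ dualReflection M u g = h ⬝ᵥ C *ᵥ g)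
    (h : Fin k → ℝ) :
    (h ⬝ᵥ C *ᵥ u) * (u ⬝ᵥ M *ᵥ u) = (h ⬝ᵥ M *ᵥ u) * (u ⬝ᵥ C *ᵥ u) := by
  -- Since `u` is sent to `-u`, invariance at the pair `(h, u)` is a linear equation for `h ⬝ᵥ C *ᵥ
  -- u`.
  have h1 : dualReflection M u u = -u := by
    rw [dualReflection, mul_div_assoc, div_self hu, mul_one, two_smul]
    abel
  have h2 := hC h u
  rw [h1, dualReflection] at h2
  simp only [mulVec_neg, dotProduct_neg, sub_dotProduct, smul_dotProduct, smul_eq_mul] at h2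
  field_simp at h2
  linarith

/-- A symmetric bilinear form invariant under the `M`-reflections along the vectors of each tier is
block diagonal and proportional to `M` on each tier. -/
lemma exists_smul_of_reflection_invariant {τ : Fin k → Fin T} {M C : Matrix (Fin k) (Fin k) ℝ}
    (hM : M.PosDef) (hMb : ∀ j l, τ j ≠ τ l → M j l = 0) (hCs : C.IsSymm)
    (hC : ∀ t u, u ≠ 0 → (∀ j, τ j ≠ t → u j = 0) → ∀ h g,
      dualReflection M u h ⬝ᵥ C *ᵥ dualReflection M u g = h ⬝ᵥ C *ᵥ g) :
    (∀ j l, τ j ≠ τ l → C j l = 0) ∧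
      ∀ t, ∃ c : ℝ, ∀ j l, τ j = t → τ l = t → C j l = c * M j l := by
  have hMs : M.IsSymm := by simpa [Matrix.IsSymm, Matrix.IsHermitian] using hM.1
  have hpos : ∀ u : Fin k → ℝ, u ≠ 0 → 0 < u ⬝ᵥ M *ᵥ u := fun u hu => by
    simpa using hM.dotProduct_mulVec_pos hu
  have key : ∀ t u, u ≠ 0 → (∀ j, τ j ≠ t → u j = 0) → ∀ h : Fin k → ℝ,
      (h ⬝ᵥ C *ᵥ u) * (u ⬝ᵥ M *ᵥ u) = (h ⬝ᵥ M *ᵥ u) * (u ⬝ᵥ C *ᵥ u) := fun t u hu hut h =>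
    reflection_invariant_form (hpos u hu).ne' (hC t u hu hut) h
  have hs : ∀ (N : Matrix (Fin k) (Fin k) ℝ) j l,
      Pi.single j (1 : ℝ) ⬝ᵥ N *ᵥ Pi.single l 1 = N j l := by
    intro N j l
    simp
  have hs0 : ∀ j, Pi.single j (1 : ℝ) ≠ (0 : Fin k → ℝ) := fun j => by simp
  have hst : ∀ j t, τ j = t → ∀ l, τ l ≠ t → (Pi.single j (1 : ℝ) : Fin k → ℝ) l = 0 := by
    intro j t hj l hl
    rw [Pi.single_apply, if_neg]
    rintro rfl
    exact hl hj
  refine ⟨fun j l hjl => ?_, fun t => ?_⟩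
  · have := key (τ l) (Pi.single l 1) (hs0 l) (hst l _ rfl) (Pi.single j 1)
    rw [hs C j l, hs M j l, hMb j l hjl, zero_mul] at this
    exact (mul_eq_zero.mp this).resolve_right (hpos _ (hs0 l)).ne'
  by_cases ht : ∃ p, τ p = t
  swap
  · exact ⟨0, fun j l hj => absurd ⟨j, hj⟩ ht⟩
  obtain ⟨p, hp⟩ := ht
  set P : Fin k → ℝ := Pi.single p 1 with hP
  have hP0 : P ≠ 0 := hs0 p
  have hPt : ∀ l, τ l ≠ t → P l = 0 := hst p t hp
  have hPM := hpos P hP0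
  set c := (P ⬝ᵥ C *ᵥ P) / (P ⬝ᵥ M *ᵥ P) with hc
  -- two non-orthogonal vectors of the tier have the same ratio
  have ratio : ∀ u v : Fin k → ℝ, u ≠ 0 → v ≠ 0 → (∀ j, τ j ≠ t → u j = 0) →
      (∀ j, τ j ≠ t → v j = 0) → u ⬝ᵥ M *ᵥ v ≠ 0 →
      (u ⬝ᵥ C *ᵥ u) * (v ⬝ᵥ M *ᵥ v) = (v ⬝ᵥ C *ᵥ v) * (u ⬝ᵥ M *ᵥ u) := by
    intro u v hu hv hut hvt huv
    have h1 := key t u hu hut v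
    have h2 := key t v hv hvt u
    rw [dotProduct_mulVec_comm hCs v u, dotProduct_mulVec_comm hMs v u] at h1
    apply mul_left_cancel₀ huv
    linear_combination (v ⬝ᵥ M *ᵥ v) * (-h1) + (u ⬝ᵥ M *ᵥ u) * h2
  have all : ∀ u : Fin k → ℝ, u ≠ 0 → (∀ j, τ j ≠ t → u j = 0) →
      u ⬝ᵥ C *ᵥ u = c * (u ⬝ᵥ M *ᵥ u) := by
    intro u hu hut
    suffices h : (u ⬝ᵥ C *ᵥ u) * (P ⬝ᵥ M *ᵥ P) = (P ⬝ᵥ C *ᵥ P) * (u ⬝ᵥ M *ᵥ u) by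
      rw [hc, div_mul_eq_mul_div, eq_div_iff hPM.ne', h]
    -- If `u` is `M`-orthogonal to `P`, then `u + P` is orthogonal to neither and links their
    -- ratios.
    by_cases huP : u ⬝ᵥ M *ᵥ P = 0
    · have hPu : P ⬝ᵥ M *ᵥ u = 0 := by rw [dotProduct_mulVec_comm hMs, huP]
      have hwt : ∀ j, τ j ≠ t → (u + P) j = 0 := fun j hj => by
        rw [Pi.add_apply, hut j hj, hPt j hj, add_zero]
      have e1 : (u + P) ⬝ᵥ M *ᵥ P = P ⬝ᵥ M *ᵥ P := by rw [add_dotProduct, huP, zero_add]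
      have e2 : (u + P) ⬝ᵥ M *ᵥ u = u ⬝ᵥ M *ᵥ u := by rw [add_dotProduct, hPu, add_zero]
      have hw0 : u + P ≠ 0 := by
        intro h
        rw [h, zero_dotProduct] at e1
        exact hPM.ne e1
      have r1 := ratio (u + P) P hw0 hP0 hwt hPt (by rw [e1]; exact hPM.ne')
      have r2 := ratio (u + P) u hw0 hu hwt hut (by rw [e2]; exact (hpos u hu).ne')
      apply mul_left_cancel₀ (hpos _ hw0).ne'
      linear_combination (u ⬝ᵥ M *ᵥ u) * r1 - (P ⬝ᵥ M *ᵥ P) * r2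
    · exact ratio u P hu hP0 hut hPt huP
  refine ⟨c, fun j l hj hl => ?_⟩
  have h1 := key t (Pi.single l 1) (hs0 l) (hst l t hl) (Pi.single j 1)
  rw [all _ (hs0 l) (hst l t hl), ← mul_assoc] at h1
  have h2 := mul_right_cancel₀ (hpos _ (hs0 l)).ne' h1
  rw [hs, hs] at h2
  rw [h2, mul_comm]

end LinearAlgebra

/-! ### Ellipsoidal laws and their symmetries. -/

section Distribution

variable {Ω : Type*} [MeasurableSpace Ω] {P : Measure Ω} {k T : ℕ}

lemma charFun_map_toLp {X : Ω → Fin k → ℝ} (hX : Measurable X) (h : Fin k → ℝ) :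
    charFun (P.map fun ω => WithLp.toLp 2 (X ω)) (WithLp.toLp 2 h)
      = ∫ ω, Complex.exp (((X ω ⬝ᵥ h : ℝ) : ℂ) * Complex.I) ∂P := by
  rw [charFun_apply, integral_map]
  · refine integral_congr_ae (ae_of_all _ fun ω => ?_)
    simp [EuclideanSpace.inner_toLp_toLp, dotProduct_comm]
  · exact ((WithLp.measurable_toLp 2 _).comp hX).aemeasurable
  · exact (by fun_prop : Continuous fun x : EuclideanSpace ℝ (Fin k) =>
      Complex.exp ((inner ℝ x (WithLp.toLp 2 h) : ℂ) * Complex.I)).aestronglyMeasurable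

lemma map_eq_of_integral_exp [IsFiniteMeasure P] {X Y : Ω → Fin k → ℝ} (hX : Measurable X)
    (hY : Measurable Y)
    (h : ∀ h : Fin k → ℝ, ∫ ω, Complex.exp (((X ω ⬝ᵥ h : ℝ) : ℂ) * Complex.I) ∂P
      = ∫ ω, Complex.exp (((Y ω ⬝ᵥ h : ℝ) : ℂ) * Complex.I) ∂P) :
    P.map X = P.map Y := by
  have hXm : Measurable fun ω => WithLp.toLp 2 (X ω) := (WithLp.measurable_toLp 2 _).comp hX
  have hYm : Measurable fun ω => WithLp.toLp 2 (Y ω) := (WithLp.measurable_toLp 2 _).comp hY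
  have key : P.map (fun ω => WithLp.toLp 2 (X ω)) = P.map fun ω => WithLp.toLp 2 (Y ω) := by
    refine Measure.ext_of_charFun (funext fun t => ?_)
    have := h (WithLp.ofLp t)
    rw [← charFun_map_toLp hX, ← charFun_map_toLp hY] at this
    simpa using this
  have := congrArg (Measure.map (WithLp.ofLp : EuclideanSpace ℝ (Fin k) → Fin k → ℝ)) key
  rwa [Measure.map_map (WithLp.measurable_ofLp 2 _) hXm,
    Measure.map_map (WithLp.measurable_ofLp 2 _) hYm] at this

variable {Y : Ω → Fin k → ℝ} {S : Matrix (Fin k) (Fin k) ℝ} {ψ : ℝ → ℂ}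

/-- One-dimensional projections of a ellipsoidal vector with the same scale have the same
law. -/
lemma identDistrib_dotProduct [IsFiniteMeasure P] (hY : Measurable Y)
    (hψ : ∀ h : Fin k → ℝ, ∫ ω, Complex.exp (((Y ω ⬝ᵥ h : ℝ) : ℂ) * Complex.I) ∂P
      = ψ (h ⬝ᵥ S *ᵥ h)) {h g : Fin k → ℝ} (hg : h ⬝ᵥ S *ᵥ h = g ⬝ᵥ S *ᵥ g) :
    IdentDistrib (fun ω => Y ω ⬝ᵥ h) (fun ω => Y ω ⬝ᵥ g) P P := by
  have hm : ∀ h : Fin k → ℝ, Measurable fun ω => Y ω ⬝ᵥ h := fun h => by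
    simp only [dotProduct]; fun_prop
  refine ⟨(hm h).aemeasurable, (hm g).aemeasurable, Measure.ext_of_charFun (funext fun s => ?_)⟩
  have e : ∀ f : Fin k → ℝ, charFun (P.map fun ω => Y ω ⬝ᵥ f) s
      = ψ (s * (s * (f ⬝ᵥ S *ᵥ f))) := by
    intro f
    rw [charFun_apply_real, integral_map (hm f).aemeasurable (by fun_prop)]
    have := hψ (s • f)
    simp only [mulVec_smul, dotProduct_smul, smul_dotProduct, smul_eq_mul] at this
    rw [← this]
    simp
  rw [e, e, hg]

lemma memLp_dotProduct (hY2 : ∀ j, MemLp (fun ω => Y ω j) 2 P) (h : Fin k → ℝ) :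
    MemLp (fun ω => Y ω ⬝ᵥ h) 2 P := by
  simp only [dotProduct]
  exact memLp_finsetSum _ fun j _ => (hY2 j).mul_const (h j)

/-- For `g ≠ 0`, the functional `h` has the same quadratic form as a suitable multiple of `g`, so
the two projections have the same law. The cross-multiplied form also covers `g = 0`. -/
lemma variance_dotProduct_proportional [IsFiniteMeasure P] (hS : S.PosDef) (hY : Measurable Y)
    (hψ : ∀ h : Fin k → ℝ, ∫ ω, Complex.exp (((Y ω ⬝ᵥ h : ℝ) : ℂ) * Complex.I) ∂P
      = ψ (h ⬝ᵥ S *ᵥ h)) (h g : Fin k → ℝ) :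
    Var[fun ω => Y ω ⬝ᵥ h; P] * (g ⬝ᵥ S *ᵥ g) = Var[fun ω => Y ω ⬝ᵥ g; P] * (h ⬝ᵥ S *ᵥ h) := by
  have hnn : ∀ u : Fin k → ℝ, 0 ≤ u ⬝ᵥ S *ᵥ u := fun u => by
    simpa using hS.posSemidef.dotProduct_mulVec_nonneg u
  by_cases hg : g = 0
  · subst hg
    have : (fun ω => Y ω ⬝ᵥ (0 : Fin k → ℝ)) = 0 := by ext; simp
    rw [this, variance_zero]
    simp
  have hgp : 0 < g ⬝ᵥ S *ᵥ g := by simpa using hS.dotProduct_mulVec_pos hg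
  set s := √((h ⬝ᵥ S *ᵥ h) / (g ⬝ᵥ S *ᵥ g)) with hs
  have hs2 : s ^ 2 = (h ⬝ᵥ S *ᵥ h) / (g ⬝ᵥ S *ᵥ g) :=
    Real.sq_sqrt (div_nonneg (hnn h) hgp.le)
  have hq : h ⬝ᵥ S *ᵥ h = (s • g) ⬝ᵥ S *ᵥ (s • g) := by
    simp only [mulVec_smul, dotProduct_smul, smul_dotProduct, smul_eq_mul]
    rw [← mul_assoc, ← sq, hs2, div_mul_cancel₀ _ hgp.ne']
  rw [(identDistrib_dotProduct hY hψ hq).variance_eq]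
  simp only [dotProduct_smul, smul_eq_mul]
  rw [variance_const_mul, hs2]
  field_simp

lemma integral_dotProduct_eq_zero [IsFiniteMeasure P] (hY : Measurable Y)
    (hψ : ∀ h : Fin k → ℝ, ∫ ω, Complex.exp (((Y ω ⬝ᵥ h : ℝ) : ℂ) * Complex.I) ∂P
      = ψ (h ⬝ᵥ S *ᵥ h)) (h : Fin k → ℝ) : ∫ ω, Y ω ⬝ᵥ h ∂P = 0 := by
  have := (identDistrib_dotProduct hY hψ (h := h) (g := -h) (by simp [mulVec_neg])).integral_eq
  simp only [dotProduct_neg, integral_neg] at this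
  linarith

/-- The law of a vector with ellipsoidal scale `M` is invariant under `M`-reflections. -/
lemma map_rowReflection_eq [IsFiniteMeasure P] {M : Matrix (Fin k) (Fin k) ℝ} (hM : M.IsSymm)
    (hY : Measurable Y)
    (hψ : ∀ h : Fin k → ℝ, ∫ ω, Complex.exp (((Y ω ⬝ᵥ h : ℝ) : ℂ) * Complex.I) ∂P
      = ψ (h ⬝ᵥ M *ᵥ h)) {u : Fin k → ℝ} (hu : u ⬝ᵥ M *ᵥ u ≠ 0) :
    P.map (fun ω => rowReflection M u (Y ω)) = P.map Y := by
  refine map_eq_of_integral_exp ((measurable_rowReflection M u).comp hY) hY fun h => ?_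
  simp only [rowReflection_dotProduct]
  rw [hψ, hψ, dualReflection_quadratic hM u h hu]

/-- Residuals of different tiers are uncorrelated. -/
lemma IsBlockGramSchmidt.integral_mul_eq_zero [IsProbabilityMeasure P] {τ : Fin k → Fin T}
    {X : Ω → Fin k → ℝ} {a : Fin k → ℝ} {B : Matrix (Fin k) (Fin k) ℝ}
    (hX2 : ∀ j, MemLp (fun ω => X ω j) 2 P) (h : IsBlockGramSchmidt P τ X a B) {j l : Fin k}
    (hjl : τ l < τ j) :
    ∫ ω, tierResidual τ a B (X ω) j * tierResidual τ a B (X ω) l ∂P = 0 := by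
  have hz : ∀ j, MemLp (fun ω => tierResidual τ a B (X ω) j) 2 P := by
    intro j
    have h1 : MemLp (fun ω => ∑ l with τ l < τ j, X ω l * B l j) 2 P :=
      memLp_finsetSum _ fun l _ => (hX2 l).mul_const (B l j)
    have h2 : MemLp (fun _ : Ω => a j) 2 P := memLp_const (a j)
    exact (hX2 j).sub (h2.add h1)
  have hint : ∀ s, Integrable (fun ω => tierResidual τ a B (X ω) j * X ω s) P := fun s =>
    (hz j).integrable_mul (hX2 s)
  have e : (fun ω => tierResidual τ a B (X ω) j * tierResidual τ a B (X ω) l)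
      = fun ω => tierResidual τ a B (X ω) j * X ω l - (tierResidual τ a B (X ω) j * a l
        + ∑ s with τ s < τ l, tierResidual τ a B (X ω) j * X ω s * B s l) := by
    ext ω
    rw [tierResidual.eq_def τ a B (X ω) l, mul_sub, mul_add, Finset.mul_sum]
    simp only [mul_assoc]
  have hsum : Integrable (fun ω =>
      ∑ s with τ s < τ l, tierResidual τ a B (X ω) j * X ω s * B s l) P :=
    integrable_finsetSum _ fun s _ => (hint s).mul_const _
  have hc : Integrable (fun ω => tierResidual τ a B (X ω) j * a l) P :=
    ((hz j).integrable one_le_two).mul_const _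
  have hcs : Integrable (fun ω => tierResidual τ a B (X ω) j * a l
      + ∑ s with τ s < τ l, tierResidual τ a B (X ω) j * X ω s * B s l) P := hc.add hsum
  rw [e, integral_sub (hint l) hcs, integral_add hc hsum,
    integral_finsetSum _ fun s _ => (hint s).mul_const _, (h j).2 l hjl, integral_mul_const,
    (h j).1, Finset.sum_eq_zero]
  · simp
  · intro s hs
    rw [integral_mul_const, (h j).2 s ((Finset.mem_filter.mp hs).2.trans hjl), zero_mul]

/-- A block diagonal scale matrix, common to all units, whose reflections preserve the law of the
tier residuals. -/
lemma exists_blockDiagonal_scale [IsProbabilityMeasure P] {ι : Type*} {τ : Fin k → Fin T}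
    {X : ι → Ω → Fin k → ℝ} (hX : ∀ i, Measurable (X i))
    (hX2 : ∀ i j, MemLp (fun ω => X i ω j) 2 P) {m : Fin k → ℝ} (hS : S.PosDef)
    (hell : ∀ i, IsEllipsoidal P (X i) m S ψ) {a : Fin k → ℝ} {B : Matrix (Fin k) (Fin k) ℝ}
    (hGS : ∀ i, IsBlockGramSchmidt P τ (X i) a B) :
    ∃ M : Matrix (Fin k) (Fin k) ℝ, M.PosDef ∧ (∀ j l, τ j ≠ τ l → M j l = 0) ∧
      ∀ i u, u ≠ 0 → P.map (fun ω => rowReflection M u (tierResidual τ a B (X i ω)))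
        = P.map fun ω => tierResidual τ a B (X i ω) := by
  set U := residualMatrix τ B
  have hψ : ∀ i (h : Fin k → ℝ), ∫ ω, Complex.exp ((((X i ω - m) ⬝ᵥ h : ℝ) : ℂ) * Complex.I) ∂P
      = ψ (h ⬝ᵥ S *ᵥ h) := fun i h => by
    rw [← (hell i).2 h, charFun_map_toLp ((hX i).sub_const m)]
  have hYm : ∀ i, Measurable fun ω => X i ω - m := fun i => (hX i).sub_const m
  have hY2 : ∀ i j, MemLp (fun ω => (X i ω - m) j) 2 P := fun i j =>
    (hX2 i j).sub (memLp_const (m j))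
  -- the residuals are centred linear images of the covariates
  have hz : ∀ i ω, tierResidual τ a B (X i ω) = (X i ω - m) ᵥ* U := by
    intro i ω
    have hd : ∀ ω, tierResidual τ a B (X i ω) = (X i ω - m) ᵥ* U + (m ᵥ* U - a) := fun ω => by
      rw [tierResidual_eq, sub_vecMul]
      abel
    -- Residuals have mean zero by orthogonality to `1`, and `X - m` has mean zero by symmetry, so
    -- no constant is left.
    have : m ᵥ* U - a = 0 := by
      ext j
      have h0 := (hGS i j).1
      have hj : (fun ω => tierResidual τ a B (X i ω) j)
          = fun ω => (X i ω - m) ⬝ᵥ (fun l => U l j) + (m ᵥ* U - a) j := by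
        ext ω
        rw [hd ω]
        rfl
      rw [hj, integral_add ((memLp_dotProduct (hY2 i) _).integrable one_le_two)
        (integrable_const _), integral_dotProduct_eq_zero (hYm i) (hψ i)] at h0
      simpa using h0
    rw [hd ω, this, add_zero]
  have hzdot : ∀ i ω h, tierResidual τ a B (X i ω) ⬝ᵥ h = (X i ω - m) ⬝ᵥ (U *ᵥ h) := fun i ω h => by
    rw [hz, dotProduct_mulVec]
  have hzm : ∀ i, Measurable fun ω => tierResidual τ a B (X i ω) := fun i => by
    simp only [hz]
    refine measurable_pi_lambda _ fun j => ?_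
    have := hYm i
    simp only [vecMul, dotProduct]
    fun_prop
  set N := Uᵀ * S * U with hN
  have hNq : ∀ h g : Fin k → ℝ, h ⬝ᵥ N *ᵥ g = (U *ᵥ h) ⬝ᵥ S *ᵥ (U *ᵥ g) := fun h g => by
    rw [hN, ← mulVec_mulVec, ← mulVec_mulVec, dotProduct_mulVec, vecMul_transpose]
  have hNpos : N.PosDef := by
    have := hS.conjTranspose_mul_mul_same
      (Matrix.mulVec_injective_iff_isUnit.mpr (residualMatrix_isUnit τ B))
    simpa [hN, conjTranspose_eq_transpose_of_trivial] using this
  have symm : ∀ {M : Matrix (Fin k) (Fin k) ℝ}, M.PosDef → M.IsSymm := fun hM => by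
    simpa [Matrix.IsSymm, Matrix.IsHermitian] using hM.1
  -- `N` is the scale matrix of the residuals and their covariance is a multiple of it. Uncorrelated
  -- tiers therefore force `N` to be block diagonal unless that multiple is zero.
  by_cases hblk : ∀ j l, τ j ≠ τ l → N j l = 0
  · refine ⟨N, hNpos, hblk, fun i u hu => ?_⟩
    refine map_rowReflection_eq (ψ := ψ) (symm hNpos) (hzm i) (fun h => ?_) ?_
    · simp only [hzdot]
      rw [hψ, hNq]
    · have := hNpos.dotProduct_mulVec_pos hu
      simpa using this.ne'
  · -- otherwise the covariates are almost surely constant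
    push Not at hblk
    obtain ⟨j, l, hjl, hN0⟩ := hblk
    have hzero : ∀ i, ∀ᵐ ω ∂P, tierResidual τ a B (X i ω) = 0 := by
      intro i
      have hz2 : ∀ j, MemLp (fun ω => tierResidual τ a B (X i ω) j) 2 P := fun j => by
        simp only [hz]
        exact memLp_dotProduct (hY2 i) _
      have hortho : cov[fun ω => tierResidual τ a B (X i ω) j,
          fun ω => tierResidual τ a B (X i ω) l; P] = 0 := by
        rw [covariance_eq_sub (hz2 j) (hz2 l), (hGS i j).1, zero_mul, sub_zero]
        rcases lt_or_gt_of_ne hjl with h | h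
        · rw [← (hGS i).integral_mul_eq_zero (hX2 i) h]
          exact integral_congr_ae (ae_of_all _ fun ω => mul_comm _ _)
        · exact (hGS i).integral_mul_eq_zero (hX2 i) h
      set p : Fin k → ℝ := Pi.single j 1
      set r : Fin k → ℝ := Pi.single l 1
      -- Zero correlation gives equal variances along `p + r` and `p - r`, yet their `N`-forms
      -- differ by `4 * N j l ≠ 0`. The factor between variance and scale must vanish.
      have hvar : Var[fun ω => (X i ω - m) ⬝ᵥ (U *ᵥ (p + r)); P]
          = Var[fun ω => (X i ω - m) ⬝ᵥ (U *ᵥ (p - r)); P] := by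
        simp only [← hzdot, dotProduct_add, dotProduct_sub, p, r, dotProduct_single_one]
        rw [variance_fun_add (hz2 j) (hz2 l), variance_fun_sub (hz2 j) (hz2 l), hortho]
        ring
      have hvar0 : ∀ g, Var[fun ω => (X i ω - m) ⬝ᵥ g; P] = 0 := by
        intro g
        have h1 := variance_dotProduct_proportional hS (hYm i) (hψ i) (U *ᵥ (p + r)) g
        have h2 := variance_dotProduct_proportional hS (hYm i) (hψ i) (U *ᵥ (p - r)) g
        rw [hvar, h2, ← hNq, ← hNq] at h1
        have hpr : r ⬝ᵥ N *ᵥ p = p ⬝ᵥ N *ᵥ r := dotProduct_mulVec_comm (symm hNpos) _ _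
        have hprN : p ⬝ᵥ N *ᵥ r = N j l := by simp [p, r]
        generalize Var[fun ω => (X i ω - m) ⬝ᵥ g; P] = v at h1 ⊢
        simp only [mulVec_add, mulVec_sub, dotProduct_add, dotProduct_sub, add_dotProduct,
          sub_dotProduct, hpr, hprN] at h1
        have h3 : v * N j l = 0 := by linarith
        exact (mul_eq_zero.mp h3).resolve_right hN0
      have hae : ∀ j, ∀ᵐ ω ∂P, tierResidual τ a B (X i ω) j = 0 := by
        intro j
        have hv : Var[fun ω => tierResidual τ a B (X i ω) j; P] = 0 := by
          simp only [hz]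
          exact hvar0 _
        have := (evariance_eq_zero_iff (hz2 j).aemeasurable).mp (by
          rw [← (hz2 j).ofReal_variance_eq, hv, ENNReal.ofReal_zero])
        rwa [(hGS i j).1] at this
      filter_upwards [ae_all_iff.mpr hae] with ω hω
      exact funext hω
    -- Almost surely zero residuals are fixed by every reflection, so any block diagonal positive
    -- definite matrix serves.
    refine ⟨1, PosDef.one, fun j l h => one_apply_ne fun h' => h (by rw [h']), fun i u _ => ?_⟩
    refine Measure.map_congr ?_
    filter_upwards [hzero i] with ω hω
    rw [hω]
    simp [rowReflection]

end Distribution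

/-! ### Symmetries that survive conditioning on acceptance. -/

section Conditioning

variable {Ω E F : Type*} [MeasurableSpace Ω] [mE : MeasurableSpace E] [MeasurableSpace F]
  {P : Measure Ω}

/-- A symmetry of the law of `Z` that preserves the acceptance probability is a symmetry of the law
of `Z` given acceptance. -/
lemma IsCondBernoulli.cond_map_eq [IsProbabilityMeasure P] {D : Ω → E} (hD : Measurable D)
    {g : E → F} (hg : Measurable g) {δ : Ω → Bool} (hδ : Measurable δ) {p : F → ℝ}
    (hp : Measurable p) (hp01 : ∀ y, p y ∈ Set.Icc (0 : ℝ) 1)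
    (h : IsCondBernoulli P D δ fun ω => p (g (D ω))) {S : F → F} (hS : Measurable S)
    (hSP : P.map (fun ω => S (g (D ω))) = P.map fun ω => g (D ω)) (hpS : ∀ y, p (S y) = p y) :
    P[|{ω | δ ω = true}].map (fun ω => S (g (D ω)))
      = P[|{ω | δ ω = true}].map fun ω => g (D ω) := by
  have hA : MeasurableSet {ω | δ ω = true} := hδ (measurableSet_singleton true)
  have hZ : Measurable fun ω => g (D ω) := hg.comp hD
  have hSZ : Measurable fun ω => S (g (D ω)) := hS.comp hZ
  have hint : Integrable (fun ω => p (g (D ω))) P := by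
    refine Integrable.of_bound (hp.comp hZ).aestronglyMeasurable 1 (ae_of_all _ fun ω => ?_)
    rw [Real.norm_eq_abs, abs_of_nonneg (hp01 _).1]
    exact (hp01 _).2
  have hpE : Measurable fun y => ENNReal.ofReal (p y) := hp.ennreal_ofReal
  -- Acceptance reweights the law of `g ∘ D` by the density `p`, up to normalization. If `S`
  -- preserves both that law and `p`, it preserves the reweighted law.
  have key : ∀ s, MeasurableSet s → P ({ω | δ ω = true} ∩ (fun ω => g (D ω)) ⁻¹' s)
      = ∫⁻ y in s, ENNReal.ofReal (p y) ∂(P.map fun ω => g (D ω)) := by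
    intro s hs
    have hsm : MeasurableSet[mE.comap D] ((fun ω => g (D ω)) ⁻¹' s) := ⟨g ⁻¹' s, hg hs, rfl⟩
    have h1 := setIntegral_condExp (μ := P) hD.comap_le
      (f := Set.indicator {ω | δ ω = true} fun _ => (1 : ℝ))
      ((integrable_const 1).indicator hA) hsm
    rw [setIntegral_congr_ae (hZ hs) (h.mono fun ω hω _ => hω), setIntegral_indicator hA,
      setIntegral_const, smul_eq_mul, mul_one] at h1
    rw [setLIntegral_map hs hpE hZ, ← ofReal_integral_eq_lintegral_ofReal hint.integrableOn
      (ae_of_all _ fun ω => (hp01 _).1), h1, Set.inter_comm, ofReal_measureReal]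
  ext s hs
  rw [Measure.map_apply hSZ hs, Measure.map_apply hZ hs, cond_apply hA, cond_apply hA]
  congr 1
  have e : (fun ω => S (g (D ω))) ⁻¹' s = (fun ω => g (D ω)) ⁻¹' (S ⁻¹' s) := rfl
  have hSP' : (P.map fun ω => g (D ω)).map S = P.map fun ω => g (D ω) := by
    rw [Measure.map_map hS hZ]
    exact hSP
  have e2 := setLIntegral_map (μ := P.map fun ω => g (D ω)) hs hpE hS
  simp only [hpS] at e2
  rw [e, key _ (hS hs), key _ hs, ← e2, hSP']

end Conditioning

/-! ### Covariance forms and their splitting over tiers. -/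

section Covariance

variable {Ω : Type*} [MeasurableSpace Ω] {P : Measure Ω}

lemma covariance_congr {X X' Y Y' : Ω → ℝ} (hX : X =ᵐ[P] X') (hY : Y =ᵐ[P] Y') :
    cov[X, Y; P] = cov[X', Y'; P] := by
  simp only [covariance, integral_congr_ae hX, integral_congr_ae hY]
  refine integral_congr_ae ?_
  filter_upwards [hX, hY] with ω h1 h2
  rw [h1, h2]

lemma covariance_comp_eq_of_map_eq {F : Type*} [MeasurableSpace F] {Z Z' : Ω → F}
    (hZ : Measurable Z) (hZ' : Measurable Z') (h : P.map Z' = P.map Z) {f g : F → ℝ}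
    (hf : Measurable f) (hg : Measurable g) :
    cov[fun ω => f (Z' ω), fun ω => g (Z' ω); P] = cov[fun ω => f (Z ω), fun ω => g (Z ω); P] := by
  rw [← covariance_map_fun hf.aestronglyMeasurable hg.aestronglyMeasurable hZ'.aemeasurable, h,
    covariance_map_fun hf.aestronglyMeasurable hg.aestronglyMeasurable hZ.aemeasurable]

lemma isSymm_covMatrix {ι : Type*} (V : Ω → ι → ℝ) : (covMatrix P V).IsSymm := by
  ext i j
  exact covariance_comm _ _

lemma covariance_dotProduct [IsFiniteMeasure P] {ι : Type*} [Fintype ι] {V : Ω → ι → ℝ}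
    (hV : ∀ j, MemLp (fun ω => V ω j) 2 P) (h g : ι → ℝ) :
    cov[fun ω => V ω ⬝ᵥ h, fun ω => V ω ⬝ᵥ g; P] = h ⬝ᵥ covMatrix P V *ᵥ g := by
  simp only [dotProduct, mulVec, covMatrix, Matrix.of_apply]
  rw [covariance_fun_sum_fun_sum (fun i => (hV i).mul_const (h i))
    (fun i => (hV i).mul_const (g i))]
  simp only [covariance_mul_const_left, covariance_mul_const_right, Finset.mul_sum]
  exact Finset.sum_congr rfl fun i _ => Finset.sum_congr rfl fun j _ => by ring

variable {k T : ℕ} {τ : Fin k → Fin T}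

lemma sum_tier_eq (t : Fin T) (f : Fin k → ℝ) (hf : ∀ j, τ j ≠ t → f j = 0) :
    ∑ j : {j // τ j = t}, f j = ∑ j, f j := by
  rw [← Finset.sum_subtype (Finset.univ.filter fun j => τ j = t) (by simp) f,
    Finset.sum_filter_of_ne]
  intro j _ hj
  by_contra h
  exact hj (hf j h)

/-- Covariances of a linear combination with the part in one tier. -/
lemma covariance_tier [IsFiniteMeasure P] {V : Ω → Fin k → ℝ}
    (hV : ∀ j, MemLp (fun ω => V ω j) 2 P) (hblk : ∀ j l, τ j ≠ τ l → covMatrix P V j l = 0)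
    {D : Ω → ℝ} {β : Fin k → ℝ} (hD : D =ᵐ[P] fun ω => V ω ⬝ᵥ β) (t : Fin T) :
    (fun j : {j // τ j = t} => cov[D, fun ω => V ω j; P])
      = covMatrix P (fun ω (j : {j // τ j = t}) => V ω j) *ᵥ fun j => β j := by
  ext ⟨j, hj⟩
  have h1 : cov[D, fun ω => V ω j; P] = Pi.single j 1 ⬝ᵥ covMatrix P V *ᵥ β := by
    rw [← covariance_dotProduct hV, covariance_comm, covariance_congr (ae_eq_refl _) hD]
    simp
  rw [h1, single_one_dotProduct]
  change ∑ l, covMatrix P V j l * β l = ∑ l : {l // τ l = t}, covMatrix P V j l * β l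
  refine (sum_tier_eq t (fun l => covMatrix P V j l * β l) fun l hl => ?_).symm
  rw [hblk j l (by rw [hj]; exact hl.symm), zero_mul]

/-- The variance of a linear combination is the sum of the contributions of the tiers. -/
lemma variance_eq_sum_tier [IsFiniteMeasure P] {V : Ω → Fin k → ℝ}
    (hV : ∀ j, MemLp (fun ω => V ω j) 2 P) (hblk : ∀ j l, τ j ≠ τ l → covMatrix P V j l = 0)
    {D : Ω → ℝ} {β : Fin k → ℝ} (hD : D =ᵐ[P] fun ω => V ω ⬝ᵥ β) :
    Var[D; P] = ∑ t, (fun j : {j // τ j = t} => β j) ⬝ᵥ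
      covMatrix P (fun ω (j : {j // τ j = t}) => V ω j) *ᵥ fun j => β j := by
  have hVD : MemLp (fun ω => V ω ⬝ᵥ β) 2 P := memLp_dotProduct hV β
  rw [variance_congr hD, ← covariance_self hVD.aemeasurable, covariance_dotProduct hV]
  simp only [← covariance_tier hV hblk (ae_eq_refl fun ω => V ω ⬝ᵥ β)]
  simp only [dotProduct]
  rw [Fintype.sum_fiberwise τ fun j => β j * cov[fun ω => ∑ i, V ω i * β i, fun ω => V ω j; P]]
  refine Finset.sum_congr rfl fun j _ => ?_
  congr 1
  have := covariance_dotProduct hV β (Pi.single j 1)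
  simp only [dotProduct_single_one] at this
  rw [dotProduct_mulVec_comm (isSymm_covMatrix V), single_one_dotProduct] at this
  exact this.symm

/-- `C` is either invertible or zero, and in the zero case both sides vanish. Thus the numerator of
`sqMultipleCorr` is correct even for a degenerate tier. -/
lemma dotProduct_inv_mulVec_of_smul_posDef {ι : Type*} [Fintype ι] [DecidableEq ι]
    {C M : Matrix ι ι ℝ} (hM : M.PosDef) {c : ℝ} (hC : C = c • M) (b : ι → ℝ) :
    (C *ᵥ b) ⬝ᵥ C⁻¹ *ᵥ (C *ᵥ b) = b ⬝ᵥ C *ᵥ b := by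
  by_cases hc : c = 0
  · simp [hC, hc]
  · have hu : IsUnit C.det := by
      rw [hC, det_smul]
      exact (((isUnit_iff_ne_zero.mpr hc).pow _).mul (isUnit_iff_ne_zero.mpr hM.det_pos.ne'))
    rw [mulVec_mulVec, nonsing_inv_mul _ hu, one_mulVec, dotProduct_comm]

end Covariance

/-! ### The mean difference as a bounded weighted sum. -/

section MeanDifference

variable {n : ℕ}

/-- The weight of unit `i` in the difference of the group means. -/
noncomputable def groupWeight (w : Fin n → Bool) (i : Fin n) : ℝ :=
  if w i = true then ((Finset.univ.filter fun i => w i = true).card : ℝ)⁻¹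
    else -((Finset.univ.filter fun i => w i = false).card : ℝ)⁻¹

lemma meanDiff_eq_sum (w : Fin n → Bool) (v : Fin n → ℝ) :
    meanDiff w v = ∑ i, groupWeight w i * v i := by
  have h : ∀ i, groupWeight w i * v i
      = (if w i = true then v i / (Finset.univ.filter fun i => w i = true).card else 0)
        - if w i = false then v i / (Finset.univ.filter fun i => w i = false).card else 0 := by
    intro i
    cases hi : w i <;> simp [groupWeight, hi, div_eq_inv_mul]
  simp only [h, Finset.sum_sub_distrib, ← Finset.sum_filter, ← Finset.sum_div, meanDiff]

lemma abs_groupWeight_le_one (w : Fin n → Bool) (i : Fin n) : |groupWeight w i| ≤ 1 := by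
  unfold groupWeight
  split_ifs
  · rw [abs_of_nonneg (by positivity)]
    exact Nat.cast_inv_le_one _
  · rw [abs_neg, abs_of_nonneg (by positivity)]
    exact Nat.cast_inv_le_one _

lemma measurable_meanDiff {F : Type*} [MeasurableSpace F] {W : F → Fin n → Bool}
    (hW : Measurable W) {v : F → Fin n → ℝ} (hv : Measurable v) :
    Measurable fun y => meanDiff (W y) (v y) := by
  simp only [meanDiff_eq_sum]
  have h : ∀ i, Measurable fun y => groupWeight (W y) i := fun i =>
    (measurable_of_finite fun w : Fin n → Bool => groupWeight w i).comp hW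
  fun_prop

lemma meanDiff_dotProduct {k : ℕ} (w : Fin n → Bool) (v : Fin n → Fin k → ℝ) (h : Fin k → ℝ) :
    meanDiff w (fun i => v i ⬝ᵥ h) = (fun j => meanDiff w fun i => v i j) ⬝ᵥ h := by
  simp only [meanDiff_eq_sum, dotProduct, Finset.mul_sum, Finset.sum_mul]
  rw [Finset.sum_comm]
  simp only [mul_assoc]

/-- Both groups are nonempty, so the constant enters each mean once and cancels. This removes the
intercept of the orthogonalization. -/
lemma meanDiff_add_const {n₁ : ℕ} (hn₁ : 0 < n₁) (hn : n₁ < n) {w : Fin n → Bool}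
    (hw : w ∈ assignments n n₁) (v : Fin n → ℝ) (c : ℝ) :
    meanDiff w (fun i => v i + c) = meanDiff w v := by
  have h1 : (Finset.univ.filter fun i => w i = true).card = n₁ := hw
  have h0 : (Finset.univ.filter fun i => w i = true).card
      + (Finset.univ.filter fun i => w i = false).card = n := by
    have := Finset.card_filter_add_card_filter_not (s := (Finset.univ : Finset (Fin n)))
      (fun i => w i = true)
    simpa using this
  have hc1 : ((Finset.univ.filter fun i => w i = true).card : ℝ) ≠ 0 := by
    rw [Nat.cast_ne_zero]; omega
  have hc0 : ((Finset.univ.filter fun i => w i = false).card : ℝ) ≠ 0 := by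
    rw [Nat.cast_ne_zero]; omega
  simp only [meanDiff, Finset.sum_add_distrib, Finset.sum_const, nsmul_eq_mul]
  field_simp
  ring

lemma memLp_meanDiff {Ω : Type*} [MeasurableSpace Ω] {P : Measure Ω} {W : Ω → Fin n → Bool}
    (hW : Measurable W) {v : Ω → Fin n → ℝ} (hv : ∀ i, MemLp (fun ω => v ω i) 2 P) :
    MemLp (fun ω => meanDiff (W ω) (v ω)) 2 P := by
  simp only [meanDiff_eq_sum]
  refine memLp_finsetSum _ fun i _ => ?_
  have h : Measurable fun ω => groupWeight (W ω) i :=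
    (measurable_of_finite fun w : Fin n → Bool => groupWeight w i).comp hW
  refine (hv i).of_le (h.aestronglyMeasurable.mul (hv i).1) (ae_of_all _ fun ω => ?_)
  rw [norm_mul, Real.norm_eq_abs (groupWeight _ _)]
  exact mul_le_of_le_one_left (norm_nonneg _) (abs_groupWeight_le_one _ _)

end MeanDifference

/-! ### From row symmetries to the covariance of mean differences, and the theorem. -/

/-- Transforming the rows of an i.i.d. sample by a symmetry of the law of every row does not change
the joint law with an independent assignment. -/
lemma map_rows_prod_eq {Ω R G : Type*} [MeasurableSpace Ω] [MeasurableSpace R] [MeasurableSpace G]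
    {P : Measure Ω} [IsProbabilityMeasure P] {n : ℕ} {z : Ω → Fin n → R}
    (hz : Measurable z) (hindep : iIndepFun (fun i ω => z ω i) P) {W : Ω → G} (hW : Measurable W)
    (hzW : IndepFun z W P) {S : R → R} (hS : Measurable S)
    (hSP : ∀ i, P.map (fun ω => S (z ω i)) = P.map fun ω => z ω i) :
    P.map (fun ω => ((fun i => S (z ω i)), W ω)) = P.map fun ω => (z ω, W ω) := by
  have hzi : ∀ i, Measurable fun ω => z ω i := fun i => (measurable_pi_apply i).comp hz
  have hSrow : Measurable fun y : Fin n → R => fun i => S (y i) :=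
    measurable_pi_lambda _ fun i => hS.comp (measurable_pi_apply i)
  have hSz : Measurable fun ω => fun i => S (z ω i) := hSrow.comp hz
  have h1 := (iIndepFun_iff_map_fun_eq_pi_map fun i => (hS.comp (hzi i)).aemeasurable).mp
    (hindep.comp (fun _ => S) fun _ => hS)
  have h2 := (iIndepFun_iff_map_fun_eq_pi_map fun i => (hzi i).aemeasurable).mp hindep
  have h3 : P.map (fun ω i => S (z ω i)) = P.map z := by
    simp only [Function.comp_def, hSP] at h1
    exact h1.trans h2.symm
  have h4 := (indepFun_iff_map_prod_eq_prod_map_map hSz.aemeasurable hW.aemeasurable).mp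
    (hzW.comp hSrow measurable_id)
  have h5 := (indepFun_iff_map_prod_eq_prod_map_map hz.aemeasurable hW.aemeasurable).mp hzW
  exact h4.trans (by rw [h5, ← h3])

/-- If the joint law of rows and assignment is invariant under the `M`-reflections along the vectors
of each tier, then the mean differences of different tiers are uncorrelated, and within a tier
their covariance is proportional to `M`. -/
lemma covMatrix_meanDiff_structure {Ω : Type*} [MeasurableSpace Ω] {Q : Measure Ω}
    [IsFiniteMeasure Q] {n k T : ℕ} {τ : Fin k → Fin T} {z : Ω → Fin n → Fin k → ℝ}
    (hz : Measurable z) {W : Ω → Fin n → Bool} (hW : Measurable W)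
    (hV : ∀ j, MemLp (fun ω => meanDiff (W ω) fun i => z ω i j) 2 Q)
    {M : Matrix (Fin k) (Fin k) ℝ} (hM : M.PosDef) (hMb : ∀ j l, τ j ≠ τ l → M j l = 0)
    (hQ : ∀ t u, u ≠ 0 → (∀ j, τ j ≠ t → u j = 0) →
      Q.map (fun ω => ((fun i => rowReflection M u (z ω i)), W ω)) = Q.map fun ω => (z ω, W ω)) :
    (∀ j l, τ j ≠ τ l →
        covMatrix Q (fun ω j => meanDiff (W ω) fun i => z ω i j) j l = 0) ∧
      ∀ t, ∃ c : ℝ, covMatrix Q (tierMeanDiff τ t z W)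
        = c • M.submatrix (Subtype.val : {j // τ j = t} → Fin k) Subtype.val := by
  have hmeas : ∀ h : Fin k → ℝ, Measurable fun y : (Fin n → Fin k → ℝ) × (Fin n → Bool) =>
      meanDiff y.2 fun i => y.1 i ⬝ᵥ h := fun h => by
    refine measurable_meanDiff measurable_snd ?_
    simp only [dotProduct]
    fun_prop
  obtain ⟨h1, h2⟩ := exists_smul_of_reflection_invariant (τ := τ) hM hMb
    (isSymm_covMatrix (P := Q) fun ω j => meanDiff (W ω) fun i => z ω i j)
    fun t u hu hut h g => by
      rw [← covariance_dotProduct hV, ← covariance_dotProduct hV]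
      have hR : Measurable fun ω => ((fun i => rowReflection M u (z ω i)), W ω) := by
        refine Measurable.prodMk (measurable_pi_lambda _ fun i => ?_) hW
        exact (measurable_rowReflection M u).comp ((measurable_pi_apply i).comp hz)
      have := covariance_comp_eq_of_map_eq (hz.prodMk hW) hR (hQ t u hu hut) (hmeas h) (hmeas g)
      simp only [rowReflection_dotProduct, meanDiff_dotProduct] at this
      exact this
  refine ⟨h1, fun t => ?_⟩
  obtain ⟨c, hc⟩ := h2 t
  refine ⟨c, ?_⟩
  ext ⟨j, hj⟩ ⟨l, hl⟩
  exact hc j l hj hl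

theorem corollary2 {Ω : Type*} [MeasurableSpace Ω] (P : Measure Ω) [IsProbabilityMeasure P]
    {n n₁ k T : ℕ} (hn₁ : 0 < n₁) (hn : n₁ < n)
    -- tier of each covariate
    (τ : Fin k → Fin T)
    -- covariates: an i.i.d. sample from an ellipsoidal distribution with finite second moments
    (x : Ω → Fin n → Fin k → ℝ) (hx : ∀ i, Measurable fun ω => x ω i)
    (hx2 : ∀ i j, MemLp (fun ω => x ω i j) 2 P)
    (hindep : iIndepFun (fun i ω => x ω i) P)
    (m : Fin k → ℝ) (S : Matrix (Fin k) (Fin k) ℝ) (ψ : ℝ → ℂ) (hS : S.PosDef)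
    (hell : ∀ i, IsEllipsoidal P (fun ω => x ω i) m S ψ)
    -- completely randomized assignment, independent of the covariates
    (W : Ω → Fin n → Bool) (hW : Measurable W)
    (hWunif : P.map W = uniformOn (assignments n n₁)) (hWx : IndepFun x W P)
    -- orthogonalized covariates
    (a : Fin k → ℝ) (B : Matrix (Fin k) (Fin k) ℝ)
    (hGS : ∀ i, IsBlockGramSchmidt P τ (fun ω => x ω i) a B)
    (z : Ω → Fin n → Fin k → ℝ) (hz : ∀ ω i, z ω i = tierResidual τ a B (x ω i))
    -- stochastic balance criterion and acceptance decision
    (φ : (Fin n → Fin k → ℝ) → (Fin n → Bool) → ℝ) (hφ : IsBalanceCriterion φ)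
    (hφinv : IsTierAffinelyInvariant τ φ)
    (δ : Ω → Bool) (hδ : Measurable δ)
    (hδφ : IsCondBernoulli P (fun ω => (x ω, W ω)) δ (fun ω => φ (z ω) (W ω)))
    (hacc : P {ω | δ ω = true} ≠ 0) :
    -- the proportional ratios exist
    (∃ ν : Fin T → ℝ, ∀ t, covMatrix P[|{ω | δ ω = true}] (tierMeanDiff τ t z W)
        = ν t • covMatrix P (tierMeanDiff τ t z W)) ∧
    -- and, with these ratios, the reduction in variance decomposes for every linear combination
    ∀ ν : Fin T → ℝ, (∀ t, covMatrix P[|{ω | δ ω = true}] (tierMeanDiff τ t z W)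
        = ν t • covMatrix P (tierMeanDiff τ t z W)) →
      ∀ (γ : Fin k → ℝ) (D : Ω → ℝ), (∀ ω, D ω = meanDiff (W ω) fun i => x ω i ⬝ᵥ γ) →
        Var[D; P] ≠ 0 →
        (Var[D; P] - Var[D; P[|{ω | δ ω = true}]]) / Var[D; P]
          = 1 - ∑ t, sqMultipleCorr P D (tierMeanDiff τ t z W) * ν t := by
  have hxm : Measurable x := measurable_pi_lambda _ hx
  set ρ : (Fin k → ℝ) → Fin k → ℝ := tierResidual τ a B
  have hρ : Measurable ρ := by
    refine measurable_pi_lambda _ fun j => ?_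
    simp only [ρ, tierResidual]
    fun_prop
  obtain rfl : z = fun ω i => ρ (x ω i) := funext fun ω => funext fun i => hz ω i
  have hρrow : Measurable fun y : Fin n → Fin k → ℝ => fun i => ρ (y i) :=
    measurable_pi_lambda _ fun i => hρ.comp (measurable_pi_apply i)
  have hzm : Measurable fun ω => fun i => ρ (x ω i) := hρrow.comp hxm
  have hz2 : ∀ i j, MemLp (fun ω => ρ (x ω i) j) 2 P := by
    intro i j
    have h1 := (memLp_dotProduct (hx2 i) fun l => residualMatrix τ B l j).sub
      (memLp_const (a j))
    simp only [ρ, tierResidual_eq]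
    exact h1
  obtain ⟨M, hM, hMb, hMP⟩ := exists_blockDiagonal_scale (X := fun i ω => x ω i) hx hx2 hS hell hGS
  set V : Ω → Fin k → ℝ := fun ω j => meanDiff (W ω) fun i => ρ (x ω i) j
  have hVP : ∀ j, MemLp (fun ω => V ω j) 2 P := fun j => memLp_meanDiff hW fun i => hz2 i j
  have hlawP : ∀ u, u ≠ 0 →
      P.map (fun ω => ((fun i => rowReflection M u (ρ (x ω i))), W ω))
        = P.map fun ω => ((fun i => ρ (x ω i)), W ω) := fun u hu =>
    map_rows_prod_eq (z := fun ω i => ρ (x ω i)) hzm (hindep.comp (fun _ => ρ) fun _ => hρ) hW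
      (hWx.comp hρrow measurable_id) (measurable_rowReflection M u) fun i => hMP i u hu
  set A : Set Ω := {ω | δ ω = true}
  have : IsProbabilityMeasure P[|A] := cond_isProbabilityMeasure hacc
  have hVQ : ∀ j, MemLp (fun ω => V ω j) 2 P[|A] := fun j =>
    ((hVP j).restrict A).smul_measure (ENNReal.inv_ne_top.mpr hacc)
  -- Here `u` must lie in one tier: `φ` is invariant only under affine maps of single tiers.
  have hlawQ : ∀ t u, u ≠ 0 → (∀ j, τ j ≠ t → u j = 0) →
      P[|A].map (fun ω => ((fun i => rowReflection M u (ρ (x ω i))), W ω))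
        = P[|A].map fun ω => ((fun i => ρ (x ω i)), W ω) := by
    intro t u hu hut
    have hu0 : u ⬝ᵥ M *ᵥ u ≠ 0 := by simpa using (hM.dotProduct_mulVec_pos hu).ne'
    obtain ⟨L, hL, hLz⟩ := exists_affineOnTier_eq_rowReflection (n := n) hMb hut hu0
    refine IsCondBernoulli.cond_map_eq (D := fun ω => (x ω, W ω)) (hxm.prodMk hW)
      (g := fun y => ((fun i => ρ (y.1 i)), y.2))
      ((hρrow.comp measurable_fst).prodMk measurable_snd) hδ (p := Function.uncurry φ) hφ.1
      (fun y => hφ.2 y.1 y.2) hδφ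
      (S := fun y => ((fun i => rowReflection M u (y.1 i)), y.2)) ?_ (hlawP u hu) ?_
    · refine Measurable.prodMk (measurable_pi_lambda _ fun i => ?_) measurable_snd
      exact (measurable_rowReflection M u).comp ((measurable_pi_apply i).comp measurable_fst)
    · intro y
      simp only [Function.uncurry]
      rw [← hLz, hφinv t L 0 hL]
  obtain ⟨hPblk, hPc⟩ := covMatrix_meanDiff_structure (Q := P) hzm hW hVP hM hMb
    fun t u hu _ => hlawP u hu
  obtain ⟨hQblk, hQc⟩ := covMatrix_meanDiff_structure (Q := P[|A]) hzm hW hVQ hM hMb hlawQ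
  have hsub : ∀ t, (M.submatrix (Subtype.val : {j // τ j = t} → Fin k) Subtype.val).PosDef :=
    fun t => hM.submatrix Subtype.val_injective
  refine ⟨?_, fun ν hν γ D hD hD0 => ?_⟩
  · have hex : ∀ t, ∃ r : ℝ, covMatrix P[|A] (tierMeanDiff τ t (fun ω i => ρ (x ω i)) W)
        = r • covMatrix P (tierMeanDiff τ t (fun ω i => ρ (x ω i)) W) := by
      intro t
      obtain ⟨c, hc⟩ := hPc t
      obtain ⟨d, hd⟩ := hQc t
      by_cases hc0 : c = 0
      · -- the mean differences of this tier are almost surely constant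
        refine ⟨0, ?_⟩
        rw [zero_smul]
        ext j l
        have hv : Var[fun ω => V ω j; P] = 0 := by
          rw [← covariance_self (hVP j).aemeasurable]
          have := congrFun (congrFun hc j) j
          rw [hc0, zero_smul] at this
          exact this
        have hae := (evariance_eq_zero_iff (hVP j).aemeasurable).mp (by
          rw [← (hVP j).ofReal_variance_eq, hv, ENNReal.ofReal_zero])
        -- Conditioning keeps null sets null, so the coordinate stays constant and its conditional
        -- covariances are zero.
        have := covariance_congr (cond_absolutelyContinuous.ae_le hae)
          (ae_eq_refl (μ := P[|A]) fun ω => V ω l)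
        rw [covariance_const_left] at this
        exact this
      · refine ⟨d / c, ?_⟩
        rw [hc, hd, smul_smul, div_mul_cancel₀ _ hc0]
    choose ν hν using hex
    exact ⟨ν, hν⟩
  -- `β` holds the coefficients of `x γ` on the residuals, up to the constant `a ⬝ᵥ β`.
  · obtain ⟨β, hβ⟩ := Matrix.mulVec_surjective_iff_isUnit.mpr (residualMatrix_isUnit τ B) γ
    have hWae : ∀ᵐ ω ∂P, W ω ∈ assignments n n₁ := by
      have : ∀ᵐ w ∂(P.map W), w ∈ assignments n n₁ := by
        rw [hWunif]
        exact ae_cond_mem (Set.toFinite _).measurableSet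
      exact ae_of_ae_map hW.aemeasurable this
    have hDV : D =ᵐ[P] fun ω => V ω ⬝ᵥ β := by
      filter_upwards [hWae] with ω hω
      have e : ∀ i, x ω i ⬝ᵥ γ = ρ (x ω i) ⬝ᵥ β + a ⬝ᵥ β := fun i => by
        simp only [ρ]
        rw [tierResidual_eq, sub_dotProduct, ← dotProduct_mulVec, hβ]
        ring
      rw [hD ω]
      simp only [e]
      rw [meanDiff_add_const hn₁ hn hω, meanDiff_dotProduct]
    have hDQ : D =ᵐ[P[|A]] fun ω => V ω ⬝ᵥ β := cond_absolutelyContinuous.ae_le hDV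
    have hVarP := variance_eq_sum_tier hVP hPblk hDV
    have hVarQ := variance_eq_sum_tier hVQ hQblk hDQ
    -- `R_t²` times the variance is the unconditional quadratic form of tier `t` at `β`, and `ν t`
    -- turns it into the conditional one. The sum over `t` is thus the ratio of conditional to
    -- unconditional variance, whichever `ν t` is chosen on a degenerate tier.
    have hterm : ∀ t, sqMultipleCorr P D (tierMeanDiff τ t (fun ω i => ρ (x ω i)) W) * ν t
        = ((fun j : {j // τ j = t} => β j) ⬝ᵥ
          covMatrix P[|A] (fun ω (j : {j // τ j = t}) => V ω j) *ᵥ fun j => β j) / Var[D; P] := by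
      intro t
      obtain ⟨c, hc⟩ := hPc t
      have h1 : (fun j => cov[D, fun ω => tierMeanDiff τ t (fun ω i => ρ (x ω i)) W ω j; P])
          = covMatrix P (tierMeanDiff τ t (fun ω i => ρ (x ω i)) W) *ᵥ fun j => β j :=
        covariance_tier hVP hPblk hDV t
      have h2 := dotProduct_inv_mulVec_of_smul_posDef (hsub t) hc fun j => β j
      have h3 : covMatrix P[|A] (fun ω (j : {j // τ j = t}) => V ω j)
          = ν t • covMatrix P (fun ω (j : {j // τ j = t}) => V ω j) := hν t
      have h4 : sqMultipleCorr P D (tierMeanDiff τ t (fun ω i => ρ (x ω i)) W)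
          = ((fun j : {j // τ j = t} => β j) ⬝ᵥ
            covMatrix P (fun ω (j : {j // τ j = t}) => V ω j) *ᵥ fun j => β j) / Var[D; P] := by
        rw [sqMultipleCorr, h1, h2]
        rfl
      rw [h4, h3, smul_mulVec, dotProduct_smul, smul_eq_mul]
      ring
    rw [Finset.sum_congr rfl fun t _ => hterm t, ← Finset.sum_div, ← hVarQ, sub_div, div_self hD0]
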